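/- Let $d\in\{2,3\}$, $N_t\ge 1$, $\Omega_t=[0,1]^{N_t}$, and let $\Omega_x\subset\mathbb R^d$ be either a bounded open convex polygon/polyhedron or a bounded $C^{1,1}$ domain. Let $H^1_0(\Omega_x)$ be normed by $\|v\|_{H^1_0(\Omega_x)}=\|\nabla v\|_{L^2(\Omega_x)}$, with dual $H^{-1}(\Omega_x)$; let $W=L^2(\Omega_t;H^1_0(\Omega_x))$, and for $F:\Omega_t\to H^{-1}(\Omega_x)$ put $$\|F\|_{W'}=\sup_{0\ne v\in W}\frac{\int_{\Omega_t}\langle F(t),v(t)\rangle\,dt}{\|v\|_W}.$$ Let $\mu(x,t)=\mu_0(x)+\sum_{i=1}^{N_t}t_i\mu_i(x)$ with $\mu_i\in L^\infty(\Omega_x)$ satisfy $0<\mu_{\min}\le\mu(x,t)\le\mu_{\max}<\infty$ for a.e. $(x,t)\in\Omega_x\times\Omega_t$, and let $f(t)=f_0+\sum_{i=1}^{N_t}t_if_i$ with $f_i\in H^{-1}(\Omega_x)$. Let $V_{h_x}\subset H^1_0(\Omega_x)$ be a finite-dimensional subspace (for instance a conforming finite element space). Then for every $t\in\Omega_t$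 there is a unique $v=u_{h_x}(\cdot,t)\in V_{h_x}$ with $$\int_{\Omega_x}\nabla v\cdot\nabla q\,dx+\int_{\Omega_x}\mu(x,t)\,v\,q\,dx=\langle f(t),q\rangle\qquad\text{for all } q\in V_{h_x}.$$ If $u_{h_x}:\Omega_t\to V_{h_x}$ satisfies this equation for a.e. $t\in\Omega_t$, then for every integer $k\ge 0$ one has $u_{h_x}\in H^k(\Omega_t;V_{h_x})\subset H^k(\Omega_t;H^1_0(\Omega_x))$, and its weak derivatives $\partial_t^\alpha u_{h_x}\in L^2(\Omega_t;V_{h_x})$ satisfy $$\sum_{|\alpha|\le k}\|\partial_t^\alpha u_{h_x}\|_{L^2(\Omega_t;H^1_0(\Omega_x))}\le C_k\Bigl(\|f\|_{W'}+\sum_{i=1}^{N_t}\|\partial_{t_i}f\|_{W'}\Bigr),$$ where $C_k$ depends only on $k$, $\Omega_x$, $N_t$, $\mu_{\min}$, $\mu_{\max}$ and the norms $\|\mu_i\|_{L^\infty(\Omega_x)}$, $i=0,\dots,N_t$; in particular $C_k$ is independent of $t$, of $f$, of $V_{h_x}$ and hence of the mesh parameter $h_x$. -/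

import Mathlib

open MeasureTheory

noncomputable section

/-! ### Spatial domains -/

/-- A bounded nonempty open convex polygon (`d = 2`) or polyhedron (`d = 3`): a finite intersection
of open half-spaces. -/
def IsConvexPolyhedralDomain {d : ℕ} (Ω : Set (EuclideanSpace ℝ (Fin d))) : Prop :=
  Ω.Nonempty ∧ Bornology.IsBounded Ω ∧
    ∃ (n : ℕ) (a : Fin n → EuclideanSpace ℝ (Fin d)) (b : Fin n → ℝ),
      Ω = {x | ∀ j, inner ℝ (a j) x < b j}

/-- A bounded nonempty open set of class `C^{1,1}`: near every boundary point it is, after a choice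
of a unit vector `ν`, the strict epigraph in direction `ν` of a `C¹` function with Lipschitz
derivative defined on the hyperplane orthogonal to `ν`. -/
def IsC11Domain {d : ℕ} (Ω : Set (EuclideanSpace ℝ (Fin d))) : Prop :=
  Ω.Nonempty ∧ IsOpen Ω ∧ Bornology.IsBounded Ω ∧
    ∀ x₀ ∈ frontier Ω, ∃ r > 0, ∃ ν : EuclideanSpace ℝ (Fin d), ‖ν‖ = 1 ∧
      ∃ γ : (Submodule.span ℝ {ν})ᗮ → ℝ,
        ContDiff ℝ 1 γ ∧ (∃ K : NNReal, LipschitzWith K (fderiv ℝ γ)) ∧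
        ∀ x ∈ Metric.ball x₀ r,
          (x ∈ Ω ↔ γ ((Submodule.span ℝ {ν})ᗮ.orthogonalProjectionOnto x) < inner ℝ ν x)

/-! ### The space `H₀¹(Ω)` -/

/-- The pairs `(φ, ∇φ)` with `φ ∈ C_c^∞(Ω)`, inside `L²(Ω) × L²(Ω; ℝᵈ)` with its Hilbert norm. -/
def testGraph {d : ℕ} (Ω : Set (EuclideanSpace ℝ (Fin d))) :
    Submodule ℝ (WithLp 2 (Lp ℝ 2 (volume.restrict Ω) ×
      Lp (EuclideanSpace ℝ (Fin d)) 2 (volume.restrict Ω))) where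
  carrier := {p | ∃ φ : EuclideanSpace ℝ (Fin d) → ℝ,
    ContDiff ℝ (⊤ : ℕ∞) φ ∧ HasCompactSupport φ ∧ tsupport φ ⊆ Ω ∧
    p.fst =ᵐ[volume.restrict Ω] φ ∧ p.snd =ᵐ[volume.restrict Ω] gradient φ}
  zero_mem' := by
    refine ⟨0, contDiff_const, HasCompactSupport.zero, by simp, ?_, ?_⟩
    · exact Lp.coeFn_zero _ _ _
    · filter_upwards [Lp.coeFn_zero (EuclideanSpace ℝ (Fin d)) 2 (volume.restrict Ω)] with x hx
      simp only [WithLp.zero_snd]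
      rw [hx]
      simp [gradient]
  add_mem' := by
    rintro p q ⟨φ, hφ, hφc, hφs, hp1, hp2⟩ ⟨ψ, hψ, hψc, hψs, hq1, hq2⟩
    refine ⟨φ + ψ, hφ.add hψ, hφc.add hψc,
      (tsupport_add φ ψ).trans (Set.union_subset hφs hψs), ?_, ?_⟩
    · filter_upwards [Lp.coeFn_add p.fst q.fst, hp1, hq1] with x h h1 h2
      simp only [WithLp.add_fst]
      rw [h]
      simp [h1, h2]
    · filter_upwards [Lp.coeFn_add p.snd q.snd, hp2, hq2] with x h h1 h2
      simp only [WithLp.add_snd]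
      rw [h]
      have e : fderiv ℝ (φ + ψ) x = fderiv ℝ φ x + fderiv ℝ ψ x :=
        fderiv_add ((hφ.differentiable (by simp)) x) ((hψ.differentiable (by simp)) x)
      simp [h1, h2, gradient, e]
  smul_mem' := by
    rintro c p ⟨φ, hφ, hφc, hφs, hp1, hp2⟩
    refine ⟨c • φ, hφ.const_smul c, hφc.smul_left (f := fun _ => c),
      (closure_mono (Function.support_const_smul_subset c φ)).trans hφs, ?_, ?_⟩
    · filter_upwards [Lp.coeFn_smul c p.fst, hp1] with x h h1
      simp only [WithLp.smul_fst]
      rw [h]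
      simp [h1]
    · filter_upwards [Lp.coeFn_smul c p.snd, hp2] with x h h1
      simp only [WithLp.smul_snd]
      rw [h]
      have e : fderiv ℝ (c • φ) x = c • fderiv ℝ φ x :=
        fderiv_const_smul ((hφ.differentiable (by simp)) x) c
      simp [h1, gradient, e]

/-- The Sobolev space `H₀¹(Ω)`, the closure of `C_c^∞(Ω)` in the `H¹` norm. An element is stored as
the pair of the function and its weak gradient (which the function determines). -/
def H01 {d : ℕ} (Ω : Set (EuclideanSpace ℝ (Fin d))) :
    Submodule ℝ (WithLp 2 (Lp ℝ 2 (volume.restrict Ω) ×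
      Lp (EuclideanSpace ℝ (Fin d)) 2 (volume.restrict Ω))) :=
  (testGraph Ω).topologicalClosure

/-- The function underlying an element of `H₀¹(Ω)`. -/
def H01.fn {d : ℕ} {Ω : Set (EuclideanSpace ℝ (Fin d))} (v : H01 Ω) :
    Lp ℝ 2 (volume.restrict Ω) :=
  v.1.fst

/-- The weak gradient of an element of `H₀¹(Ω)`. -/
def H01.grad {d : ℕ} {Ω : Set (EuclideanSpace ℝ (Fin d))} (v : H01 Ω) :
    Lp (EuclideanSpace ℝ (Fin d)) 2 (volume.restrict Ω) :=
  v.1.snd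

/-! ### The parameter domain and Bochner–Sobolev spaces over it -/

/-- The parameter domain `Ω_t = [0,1]^N`. -/
def paramCube (N : ℕ) : Set (Fin N → ℝ) := Set.Icc 0 1

/-- Affine dependence on the parameter: `c₀ + ∑ᵢ tᵢ cᵢ`. -/
def affineParam {N : ℕ} {X : Type*} [AddCommGroup X] [Module ℝ X] (c : Fin (N + 1) → X)
    (t : Fin N → ℝ) : X :=
  c 0 + ∑ i : Fin N, t i • c i.succ

/-- The classical partial derivative `∂g/∂tᵢ`. -/
def partialDeriv {N : ℕ} {X : Type*} [NormedAddCommGroup X] [NormedSpace ℝ X] (i : Fin N)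
    (g : (Fin N → ℝ) → X) (t : Fin N → ℝ) : X :=
  fderiv ℝ g t (Pi.single i 1)

/-- The classical iterated derivative `∂^α φ = ∂₁^{α₁} ⋯ ∂_N^{α_N} φ`. -/
def multiDeriv {N : ℕ} (α : Fin N → ℕ) (φ : (Fin N → ℝ) → ℝ) : (Fin N → ℝ) → ℝ :=
  (List.finRange N).foldr (fun i g => (partialDeriv i)^[α i] g) φ

/-- The multi-indices `α ∈ ℕ^N` with `|α| ≤ k`. -/
def multiIndices (N k : ℕ) : Finset (Fin N → ℕ) :=
  (Fintype.piFinset fun _ => Finset.range (k + 1)).filter fun α => ∑ i, α i ≤ k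

/-- `w` is the weak derivative `∂_t^α u` on `Ω_t` (for `u`, `w` integrable over `Ω_t`). -/
def IsWeakDeriv {N : ℕ} {X : Type*} [NormedAddCommGroup X] [NormedSpace ℝ X] (α : Fin N → ℕ)
    (u w : (Fin N → ℝ) → X) : Prop :=
  ∀ φ : (Fin N → ℝ) → ℝ, ContDiff ℝ (⊤ : ℕ∞) φ → HasCompactSupport φ →
    tsupport φ ⊆ interior (paramCube N) →
    ∫ t in paramCube N, multiDeriv α φ t • u t =
      (-1 : ℝ) ^ (∑ i, α i) • ∫ t in paramCube N, φ t • w t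

/-- `w` is the weak derivative `∂_t^α u` and lies in `L²(Ω_t; X)`. -/
def IsL2WeakDeriv {N : ℕ} {X : Type*} [NormedAddCommGroup X] [NormedSpace ℝ X] (α : Fin N → ℕ)
    (u w : (Fin N → ℝ) → X) : Prop :=
  MemLp w 2 (volume.restrict (paramCube N)) ∧ IsWeakDeriv α u w

/-- `u ∈ H^k(Ω_t; X)`. -/
def MemHk {N : ℕ} {X : Type*} [NormedAddCommGroup X] [NormedSpace ℝ X] (k : ℕ)
    (u : (Fin N → ℝ) → X) : Prop :=
  MemLp u 2 (volume.restrict (paramCube N)) ∧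
    ∀ α : Fin N → ℕ, ∑ i, α i ≤ k → ∃ w, IsL2WeakDeriv α u w

/-- The norm of `W = L²(Ω_t; H₀¹(Ω))`, namely `(∫_{Ω_t} ‖∇v(t)‖²_{L²(Ω)} dt)^{1/2}`. -/
def wNorm {d N : ℕ} {Ω : Set (EuclideanSpace ℝ (Fin d))} (v : (Fin N → ℝ) → H01 Ω) : ENNReal :=
  eLpNorm (fun t => H01.grad (v t)) 2 (volume.restrict (paramCube N))

/-- The dual norm `‖F‖_{W'}`, the supremum over `0 ≠ v ∈ W` of
`(∫_{Ω_t} ⟨F(t), v(t)⟩ dt) / ‖v‖_W`. -/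
def wDualNorm {d N : ℕ} {Ω : Set (EuclideanSpace ℝ (Fin d))}
    (F : (Fin N → ℝ) → StrongDual ℝ (H01 Ω)) : ENNReal :=
  ⨆ (v : Lp (H01 Ω) 2 (volume.restrict (paramCube N))) (_ : v ≠ 0),
    ENNReal.ofReal (∫ t in paramCube N, F t (v t)) / wNorm v

/-! ### The Galerkin problem -/

/-- `u ∈ V` solves the Galerkin problem at the parameter `t`, with potential
`μ(x,t) = μ₀(x) + ∑ᵢ tᵢ μᵢ(x)` and source `f(t) = f₀ + ∑ᵢ tᵢ fᵢ`. -/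
def IsGalerkinSolution {d N : ℕ} {Ω : Set (EuclideanSpace ℝ (Fin d))}
    (μ : Fin (N + 1) → Lp ℝ ⊤ (volume.restrict Ω)) (f : Fin (N + 1) → StrongDual ℝ (H01 Ω))
    (V : Submodule ℝ (H01 Ω)) (t : Fin N → ℝ) (u : V) : Prop :=
  ∀ v : V,
    (∫ x in Ω, inner ℝ (H01.grad (u : H01 Ω) x) (H01.grad (v : H01 Ω) x)) +
      (∫ x in Ω, affineParam (fun i => μ i x) t * H01.fn (u : H01 Ω) x * H01.fn (v : H01 Ω) x) =
    affineParam f t (v : H01 Ω)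

end

/-!
On a finite-dimensional `V` the Galerkin problem reads `A(t) u(t) = f(t)`, where
`A(t) = a₀ + ∑ᵢ tᵢ aᵢ : V → V'` is affine in the parameter. Since `μ ≥ μmin > 0`, the form of `A(t)`
is bounded below by `min 1 μmin` in the full `H¹` norm, for every `t` in the closed cube
(`mul_norm_le_norm_galerkinOperator`). Hence `A(t)` is invertible on an open set containing the cube
and `u = A⁻¹ f` is smooth there, so its classical derivatives are its weak derivatives
(`isL2WeakDeriv_dirDeriv`), and weak derivatives are unique (`IsL2WeakDeriv.ae_eq`).

For the estimate, differentiating the equation gives `A(t) ∂ᵢu = ∂ᵢf - aᵢ u`: the first derivative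
solves the same equation with a source that is controlled by `f` and `u`. Induction on the order
(`derivsBoundedBy_paramSolution`) bounds all derivatives of order at most `k`, pointwise on the
cube, by a constant times a common bound of `f(t)` and `∂ᵢf`; the constant involves only `k`, the
coercivity constant and the norms of the `aᵢ`, which are at most `‖μᵢ‖`.

Such a common bound is the sum of the dual norms of `f` and of the `∂ᵢf`. As `∂ᵢf` does not depend
on `t`, testing with constant functions of `t` recovers its norm. The same test applied to `f`
controls the mean of `f` over the cube, from which `f(t)` differs by at most the sum of the norms of
the `∂ᵢf` (`norm_affineParam_le_of_integral_le`). The gradient norm is at most the full `H¹` norm,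
so the dual norm taken with respect to it dominates the one needed here and no Poincaré inequality
enters. Everything is carried out for an abstract energy space `H` with bounded maps `P`, `G` such
that `‖v‖² = ‖P v‖² + ‖G v‖²`, and then specialized to `H₀¹(Ω)`.
-/

/-! ### Iterated directional derivatives -/

/-- The iterated derivative of `g` along the coordinate directions listed in `s`, the head of the
list being differentiated first: `dirDeriv [i, j] g = ∂ⱼ ∂ᵢ g`. -/
noncomputable def dirDeriv {N : ℕ} {X : Type*} [NormedAddCommGroup X] [NormedSpace ℝ X]
    (s : List (Fin N)) (g : (Fin N → ℝ) → X) : (Fin N → ℝ) → X :=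
  s.foldl (fun h i => partialDeriv i h) g

section DirDeriv

variable {N : ℕ} {X Y : Type*} [NormedAddCommGroup X] [NormedSpace ℝ X]
  [NormedAddCommGroup Y] [NormedSpace ℝ Y] {O : Set (Fin N → ℝ)}

theorem dirDeriv_cons (i : Fin N) (s : List (Fin N)) (g : (Fin N → ℝ) → X) :
    dirDeriv (i :: s) g = dirDeriv s (partialDeriv i g) := rfl

theorem partialDeriv_eqOn (hO : IsOpen O) (i : Fin N) {g h : (Fin N → ℝ) → X}
    (hgh : Set.EqOn g h O) : Set.EqOn (partialDeriv i g) (partialDeriv i h) O := by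
  intro t ht
  have : g =ᶠ[nhds t] h := Filter.eventuallyEq_of_mem (hO.mem_nhds ht) hgh
  simp only [partialDeriv, this.fderiv_eq]

theorem ContDiffOn.partialDeriv (hO : IsOpen O) (i : Fin N) {g : (Fin N → ℝ) → X}
    (hg : ContDiffOn ℝ (⊤ : ℕ∞) g O) : ContDiffOn ℝ (⊤ : ℕ∞) (partialDeriv i g) O :=
  (hg.fderiv_of_isOpen hO (by simp)).clm_apply contDiffOn_const

theorem ContDiffOn.dirDeriv (hO : IsOpen O) (s : List (Fin N)) {g : (Fin N → ℝ) → X}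
    (hg : ContDiffOn ℝ (⊤ : ℕ∞) g O) : ContDiffOn ℝ (⊤ : ℕ∞) (dirDeriv s g) O := by
  induction s generalizing g with
  | nil => exact hg
  | cons i s ih => exact ih (hg.partialDeriv hO i)

theorem dirDeriv_eqOn (hO : IsOpen O) (s : List (Fin N)) {g h : (Fin N → ℝ) → X}
    (hgh : Set.EqOn g h O) : Set.EqOn (dirDeriv s g) (dirDeriv s h) O := by
  induction s generalizing g h with
  | nil => exact hgh
  | cons i s ih => exact ih (partialDeriv_eqOn hO i hgh)

theorem ContDiffOn.differentiableAt_of_isOpen (hO : IsOpen O) {g : (Fin N → ℝ) → X}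
    (hg : ContDiffOn ℝ (⊤ : ℕ∞) g O) {t : Fin N → ℝ} (ht : t ∈ O) : DifferentiableAt ℝ g t :=
  (hg.contDiffAt (hO.mem_nhds ht)).differentiableAt (by simp)

/-- Derivatives of the source `g - L u` arising when an affine equation is differentiated. -/
theorem dirDeriv_sub_clm_comp_eqOn (hO : IsOpen O) (L : X →L[ℝ] Y) (s : List (Fin N))
    {g : (Fin N → ℝ) → Y} {u : (Fin N → ℝ) → X}
    (hg : ContDiffOn ℝ (⊤ : ℕ∞) g O) (hu : ContDiffOn ℝ (⊤ : ℕ∞) u O) :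
    Set.EqOn (dirDeriv s fun t => g t - L (u t)) (fun t => dirDeriv s g t - L (dirDeriv s u t))
      O := by
  induction s generalizing g u with
  | nil => exact fun t _ => rfl
  | cons i s ih =>
    intro t ht
    simp only [dirDeriv_cons]
    refine Eq.trans ?_ (ih (hg.partialDeriv hO i) (hu.partialDeriv hO i) ht)
    refine dirDeriv_eqOn hO s (fun x hx => ?_) ht
    have hgx := (hg.differentiableAt_of_isOpen hO hx).hasFDerivAt
    have hux := (hu.differentiableAt_of_isOpen hO hx).hasFDerivAt
    have : HasFDerivAt (fun t => g t - L (u t)) (fderiv ℝ g x - L.comp (fderiv ℝ u x)) x :=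
      hgx.sub (L.hasFDerivAt.comp x hux)
    simp [partialDeriv, this.fderiv]

end DirDeriv

/-! ### Weak derivatives of smooth functions on the parameter cube -/

/-- The list of directions of a multi-index: each `i` repeated `α i` times, in increasing order. -/
def multiIndexDirs {N : ℕ} (α : Fin N → ℕ) : List (Fin N) :=
  (List.finRange N).flatMap fun i => List.replicate (α i) i

theorem length_multiIndexDirs {N : ℕ} (α : Fin N → ℕ) :
    (multiIndexDirs α).length = ∑ i, α i := by
  simp [multiIndexDirs, List.length_flatMap, Fin.sum_univ_def]

theorem multiDeriv_eq_foldr {N : ℕ} (α : Fin N → ℕ) (φ : (Fin N → ℝ) → ℝ) :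
    multiDeriv α φ = (multiIndexDirs α).foldr partialDeriv φ := by
  have h : ∀ (i : Fin N) (n : ℕ) (g : (Fin N → ℝ) → ℝ),
      (List.replicate n i).foldr partialDeriv g = (partialDeriv i)^[n] g := by
    intro i n g
    induction n with
    | zero => rfl
    | succ n ih => rw [List.replicate_succ, List.foldr_cons, ih, Function.iterate_succ_apply']
  simp only [multiDeriv, multiIndexDirs, List.foldr_flatMap, h]

section WeakDeriv

variable {N : ℕ} {X : Type*} [NormedAddCommGroup X] [NormedSpace ℝ X] {O : Set (Fin N → ℝ)}

theorem isCompact_paramCube (N : ℕ) : IsCompact (paramCube N) := isCompact_Icc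

theorem volume_paramCube (N : ℕ) : volume (paramCube N) = 1 := by
  simp [paramCube, Real.volume_Icc_pi]

instance isProbabilityMeasure_paramCube (N : ℕ) :
    IsProbabilityMeasure (volume.restrict (paramCube N)) :=
  ⟨by simp [volume_paramCube]⟩

theorem tsupport_partialDeriv_subset (i : Fin N) (φ : (Fin N → ℝ) → X) :
    tsupport (partialDeriv i φ) ⊆ tsupport φ := by
  refine closure_minimal (fun t ht => ?_) (isClosed_tsupport φ)
  refine support_fderiv_subset ℝ (f := φ) fun h => ht ?_
  simp [partialDeriv, h]

theorem integral_partialDeriv_smul_eq_neg (hO : IsOpen O) (hQO : paramCube N ⊆ O) (i : Fin N)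
    {φ : (Fin N → ℝ) → ℝ} (hφ : ContDiff ℝ (⊤ : ℕ∞) φ) (hφs : tsupport φ ⊆ interior (paramCube N))
    {u : (Fin N → ℝ) → X} (hu : ContDiffOn ℝ (⊤ : ℕ∞) u O) :
    ∫ t in paramCube N, partialDeriv i φ t • u t =
      -∫ t in paramCube N, φ t • partialDeriv i u t := by
  have hsub : tsupport φ ⊆ paramCube N := hφs.trans interior_subset
  have hout : ∀ {ψ : (Fin N → ℝ) → ℝ} {v : (Fin N → ℝ) → X}, tsupport ψ ⊆ paramCube N →
      ∀ t, t ∉ paramCube N → ψ t • v t = 0 := fun hψ t ht => by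
    rw [image_eq_zero_of_notMem_tsupport fun h => ht (hψ h), zero_smul]
  have hint : ∀ {ψ : (Fin N → ℝ) → ℝ} {v : (Fin N → ℝ) → X}, Continuous ψ →
      tsupport ψ ⊆ paramCube N → ContinuousOn v O → Integrable (fun t => ψ t • v t) := by
    intro ψ v hψ hψs hv
    refine (integrableOn_iff_integrable_of_support_subset (s := paramCube N) fun t ht => ?_).1
      ((hψ.continuousOn.smul (hv.mono hQO)).integrableOn_compact (isCompact_paramCube N))
    by_contra h
    exact ht (hout hψs t h)
  have hdφ : Continuous (partialDeriv i φ) :=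
    (hφ.continuous_fderiv (by simp)).clm_apply continuous_const
  have hdφs := (tsupport_partialDeriv_subset i φ).trans hsub
  rw [setIntegral_eq_integral_of_forall_compl_eq_zero (hout hdφs),
    setIntegral_eq_integral_of_forall_compl_eq_zero (hout hsub), eq_neg_iff_add_eq_zero, add_comm,
    ← eq_neg_iff_add_eq_zero]
  exact integral_smul_fderiv_eq_neg_fderiv_smul_of_integrable
    (hint hdφ hdφs hu.continuousOn)
    (hint hφ.continuous hsub (hu.partialDeriv hO i).continuousOn)
    (hint hφ.continuous hsub hu.continuousOn)
    (fun t _ => hφ.differentiable (by simp) t)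
    (fun t ht => hu.differentiableAt_of_isOpen hO (hQO (hsub ht)))

theorem contDiff_foldr_partialDeriv (s : List (Fin N)) {φ : (Fin N → ℝ) → X}
    (hφ : ContDiff ℝ (⊤ : ℕ∞) φ) : ContDiff ℝ (⊤ : ℕ∞) (s.foldr partialDeriv φ) := by
  induction s with
  | nil => exact hφ
  | cons i s ih =>
    exact contDiffOn_univ.1 ((contDiffOn_univ.2 ih).partialDeriv isOpen_univ i)

theorem tsupport_foldr_partialDeriv_subset (s : List (Fin N)) (φ : (Fin N → ℝ) → X) :
    tsupport (s.foldr partialDeriv φ) ⊆ tsupport φ := by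
  induction s with
  | nil => exact subset_rfl
  | cons i s ih => exact (tsupport_partialDeriv_subset i _).trans ih

/-- Integrating by parts peels the outermost derivative off the test function and puts it innermost
on `u`, which is the order of differentiation in `dirDeriv`, so symmetry is not needed. -/
theorem isWeakDeriv_dirDeriv (hO : IsOpen O) (hQO : paramCube N ⊆ O) {u : (Fin N → ℝ) → X}
    (hu : ContDiffOn ℝ (⊤ : ℕ∞) u O) (α : Fin N → ℕ) :
    IsWeakDeriv α u (dirDeriv (multiIndexDirs α) u) := by
  intro φ hφ hφc hφs
  rw [multiDeriv_eq_foldr, ← length_multiIndexDirs]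
  generalize multiIndexDirs α = s
  induction s generalizing u with
  | nil => simp [dirDeriv]
  | cons i s ih =>
    have hsub := tsupport_foldr_partialDeriv_subset s φ
    rw [List.foldr_cons, integral_partialDeriv_smul_eq_neg hO hQO i
      (contDiff_foldr_partialDeriv s hφ) (hsub.trans hφs) hu, ih (hu.partialDeriv hO i),
      dirDeriv_cons, List.length_cons, pow_succ]
    simp

theorem ContDiffOn.memLp_paramCube (hQO : paramCube N ⊆ O) {u : (Fin N → ℝ) → X}
    (hu : ContDiffOn ℝ (⊤ : ℕ∞) u O) : MemLp u 2 (volume.restrict (paramCube N)) := by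
  have hc := hu.continuousOn.mono hQO
  obtain ⟨B, hB⟩ := (isCompact_paramCube N).exists_bound_of_continuousOn hc
  have hm : MeasurableSet (paramCube N) := measurableSet_Icc
  exact MemLp.of_bound (hc.aestronglyMeasurable_of_isCompact (isCompact_paramCube N) hm) B
    (ae_restrict_of_forall_mem hm hB)

theorem isL2WeakDeriv_dirDeriv (hO : IsOpen O) (hQO : paramCube N ⊆ O)
    {u v : (Fin N → ℝ) → X} (hu : ContDiffOn ℝ (⊤ : ℕ∞) u O)
    (hv : v =ᵐ[volume.restrict (paramCube N)] u) (α : Fin N → ℕ) :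
    IsL2WeakDeriv α v (dirDeriv (multiIndexDirs α) u) := by
  refine ⟨(hu.dirDeriv hO _).memLp_paramCube hQO, fun φ hφ hφc hφs => ?_⟩
  rw [← isWeakDeriv_dirDeriv hO hQO hu α φ hφ hφc hφs]
  refine integral_congr_ae ?_
  filter_upwards [hv] with t ht
  rw [ht]

theorem memHk_of_ae_eq_contDiffOn (hO : IsOpen O) (hQO : paramCube N ⊆ O)
    {u v : (Fin N → ℝ) → X} (hu : ContDiffOn ℝ (⊤ : ℕ∞) u O)
    (hv : v =ᵐ[volume.restrict (paramCube N)] u) (k : ℕ) : MemHk k v :=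
  ⟨(hu.memLp_paramCube hQO).ae_eq hv.symm,
    fun α _ => ⟨_, isL2WeakDeriv_dirDeriv hO hQO hu hv α⟩⟩

theorem IsL2WeakDeriv.ae_eq [CompleteSpace X] {α : Fin N → ℕ} {u w₁ w₂ : (Fin N → ℝ) → X}
    (h₁ : IsL2WeakDeriv α u w₁) (h₂ : IsL2WeakDeriv α u w₂) :
    w₁ =ᵐ[volume.restrict (paramCube N)] w₂ := by
  have hi₁ : IntegrableOn w₁ (paramCube N) := h₁.1.integrable (by norm_num)
  have hi₂ : IntegrableOn w₂ (paramCube N) := h₂.1.integrable (by norm_num)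
  have hint : IntegrableOn (fun t => w₁ t - w₂ t) (paramCube N) := hi₁.sub hi₂
  have hzero : ∀ᵐ t ∂(volume : Measure (Fin N → ℝ)),
      t ∈ interior (paramCube N) → w₁ t - w₂ t = 0 := by
    refine isOpen_interior.ae_eq_zero_of_integral_contDiff_smul_eq_zero
      (hint.mono_set interior_subset).locallyIntegrableOn fun φ hφ hφc hφs => ?_
    have hsub : tsupport φ ⊆ paramCube N := hφs.trans interior_subset
    rw [← setIntegral_eq_integral_of_forall_compl_eq_zero (s := paramCube N)]
    · have hφi : ∀ {w : (Fin N → ℝ) → X}, IntegrableOn w (paramCube N) →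
          IntegrableOn (fun t => φ t • w t) (paramCube N) := by
        intro w hw
        obtain ⟨B, hB⟩ := hφ.continuous.bounded_above_of_compact_support hφc
        exact hw.bdd_smul B hφ.continuous.aestronglyMeasurable (ae_of_all _ hB)
      simp_rw [smul_sub]
      rw [integral_sub (hφi hi₁) (hφi hi₂), sub_eq_zero]
      have := (h₁.2 φ hφ hφc hφs).symm.trans (h₂.2 φ hφ hφc hφs)
      exact (smul_right_injective X (pow_ne_zero _ (by norm_num : (-1 : ℝ) ≠ 0))) this
    · intro t ht
      rw [image_eq_zero_of_notMem_tsupport fun h => ht (hsub h), zero_smul]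
  have hfr : ∀ᵐ t ∂(volume : Measure (Fin N → ℝ)), t ∉ frontier (paramCube N) :=
    measure_eq_zero_iff_ae_notMem.1 ((convex_Icc (0 : Fin N → ℝ) 1).addHaar_frontier volume)
  have hm : MeasurableSet (paramCube N) := measurableSet_Icc
  refine (ae_restrict_iff' hm).2 ?_
  filter_upwards [hzero, hfr] with t ht hf htQ
  refine sub_eq_zero.1 (ht ?_)
  by_contra hti
  exact hf ⟨subset_closure htQ, hti⟩

end WeakDeriv

/-! ### Linear equations depending affinely on a parameter -/

section AffineParam

variable {N : ℕ} {X Y : Type*} [NormedAddCommGroup X] [NormedSpace ℝ X]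
  [NormedAddCommGroup Y] [NormedSpace ℝ Y]

theorem affineParam_apply_clm (a : Fin (N + 1) → X →L[ℝ] Y) (t : Fin N → ℝ) (x : X) :
    affineParam a t x = affineParam (fun i => a i x) t := by
  simp [affineParam]

theorem contDiff_affineParam {n : WithTop ℕ∞} (c : Fin (N + 1) → X) :
    ContDiff ℝ n (affineParam c) := by
  unfold affineParam
  fun_prop

theorem partialDeriv_affineParam (c : Fin (N + 1) → X) (i : Fin N) :
    partialDeriv i (affineParam c) = fun _ => c i.succ := by
  funext t
  have h : HasFDerivAt (affineParam c)
      (∑ j : Fin N, (ContinuousLinearMap.proj (R := ℝ) (φ := fun _ : Fin N => ℝ) j).smulRight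
        (c j.succ)) t := by
    refine (HasFDerivAt.fun_sum fun j _ => ?_).const_add (c 0)
    exact (hasFDerivAt_apply j t).smul_const (c j.succ)
  simp [partialDeriv, h.fderiv, Pi.single_apply]

/-- All derivatives of `g` of order at most `n` are bounded by `B` on the parameter cube. -/
def DerivsBoundedBy (n : ℕ) (B : ℝ) (g : (Fin N → ℝ) → X) : Prop :=
  ∀ s : List (Fin N), s.length ≤ n → ∀ t ∈ paramCube N, ‖dirDeriv s g t‖ ≤ B

theorem derivsBoundedBy_affineParam {c : Fin (N + 1) → X} {B : ℝ}
    (h0 : ∀ t ∈ paramCube N, ‖affineParam c t‖ ≤ B) (h1 : ∀ i : Fin N, ‖c i.succ‖ ≤ B) (n : ℕ) :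
    DerivsBoundedBy n B (affineParam c) := by
  have hconst : ∀ (s : List (Fin N)) (x : X), ‖x‖ ≤ B → ∀ t, ‖dirDeriv s (fun _ => x) t‖ ≤ B := by
    intro s
    induction s with
    | nil => exact fun x hx _ => hx
    | cons i s ih =>
      intro x hx t
      have h : partialDeriv i (fun _ : Fin N → ℝ => x) = fun _ => 0 := by
        funext t
        simp [partialDeriv]
      rw [dirDeriv_cons, h]
      exact ih 0 (by simpa using (norm_nonneg x).trans hx) t
  intro s _ t ht
  cases s with
  | nil => exact h0 t ht
  | cons i s =>
    rw [dirDeriv_cons, partialDeriv_affineParam]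
    exact hconst s _ (h1 i) t

/-- The parameters at which the operator `a₀ + ∑ᵢ tᵢ aᵢ` is an isomorphism. -/
def regularParams (a : Fin (N + 1) → X →L[ℝ] Y) : Set (Fin N → ℝ) :=
  {t | affineParam a t ∈ Set.range ((↑) : (X ≃L[ℝ] Y) → X →L[ℝ] Y)}

/-- The solution `u(t)` of `(a₀ + ∑ᵢ tᵢ aᵢ) u(t) = g(t)`; zero where the operator is not
invertible. -/
noncomputable def paramSolution (a : Fin (N + 1) → X →L[ℝ] Y) (g : (Fin N → ℝ) → Y)
    (t : Fin N → ℝ) : X :=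
  (affineParam a t).inverse (g t)

theorem isOpen_regularParams [CompleteSpace X] (a : Fin (N + 1) → X →L[ℝ] Y) :
    IsOpen (regularParams a) :=
  ContinuousLinearEquiv.isOpen.preimage (contDiff_affineParam (n := 0) a).continuous

theorem affineParam_paramSolution {a : Fin (N + 1) → X →L[ℝ] Y} (g : (Fin N → ℝ) → Y)
    {t : Fin N → ℝ} (ht : t ∈ regularParams a) : affineParam a t (paramSolution a g t) = g t := by
  obtain ⟨e, he⟩ := ht
  simp [paramSolution, ← he]

theorem eq_paramSolution {a : Fin (N + 1) → X →L[ℝ] Y} {g : (Fin N → ℝ) → Y}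
    {t : Fin N → ℝ} (ht : t ∈ regularParams a) {x : X} (hx : affineParam a t x = g t) :
    x = paramSolution a g t := by
  obtain ⟨e, he⟩ := ht
  simp only [paramSolution, ← he, ContinuousLinearMap.inverse_equiv, ← hx]
  simp

theorem contDiffOn_paramSolution [CompleteSpace X] (a : Fin (N + 1) → X →L[ℝ] Y)
    {g : (Fin N → ℝ) → Y} (hg : ContDiffOn ℝ (⊤ : ℕ∞) g (regularParams a)) :
    ContDiffOn ℝ (⊤ : ℕ∞) (paramSolution a g) (regularParams a) := by
  intro t ht
  obtain ⟨e, he⟩ := id ht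
  have hinv : ContDiffAt ℝ (⊤ : ℕ∞) (fun s => (affineParam a s).inverse) t :=
    ContDiffAt.comp t (he ▸ contDiffAt_map_inverse e) (contDiff_affineParam a).contDiffAt
  exact hinv.contDiffWithinAt.clm_apply (hg t ht)

/-- Differentiating the equation: `∂ᵢu` solves the same equation with source `∂ᵢg - aᵢ u`. -/
theorem partialDeriv_paramSolution_eqOn [CompleteSpace X] (a : Fin (N + 1) → X →L[ℝ] Y)
    {g : (Fin N → ℝ) → Y} (hg : ContDiffOn ℝ (⊤ : ℕ∞) g (regularParams a)) (i : Fin N) :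
    Set.EqOn (partialDeriv i (paramSolution a g))
      (paramSolution a fun t => partialDeriv i g t - a i.succ (paramSolution a g t))
      (regularParams a) := by
  have hO := isOpen_regularParams a
  intro t ht
  refine eq_paramSolution ht ?_
  have hu := ((contDiffOn_paramSolution a hg).differentiableAt_of_isOpen hO ht).hasFDerivAt
  have hA := ((contDiff_affineParam (n := 1) a).differentiable (by simp) t).hasFDerivAt
  have h : partialDeriv i (fun s => affineParam a s (paramSolution a g s)) t =
      partialDeriv i g t :=
    partialDeriv_eqOn hO i (fun s hs => affineParam_paramSolution g hs) ht
  have hAi : fderiv ℝ (affineParam a) t (Pi.single i 1) = a i.succ :=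
    congrFun (partialDeriv_affineParam a i) t
  rw [← h]
  simp only [partialDeriv]
  rw [(hA.clm_apply hu).fderiv]
  simp [hAi]

/-- The constant `Cₙ` in the bound by `Cₙ B` of the derivatives up to order `n` of a solution whose
source has derivatives bounded by `B`, where `c` is the coercivity constant and `K` bounds the
operators `aᵢ`, `i ≥ 1`. -/
noncomputable def solutionConst (c K : ℝ) : ℕ → ℝ
  | 0 => c⁻¹
  | n + 1 => solutionConst c K n * (1 + K * solutionConst c K n) + c⁻¹

theorem solutionConst_pos {c K : ℝ} (hc : 0 < c) (hK : 0 ≤ K) (n : ℕ) :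
    0 < solutionConst c K n := by
  induction n with
  | zero => exact inv_pos.2 hc
  | succ n ih =>
    rw [solutionConst]
    positivity

theorem norm_paramSolution_le {a : Fin (N + 1) → X →L[ℝ] Y} {c B : ℝ} (hc : 0 < c)
    {t : Fin N → ℝ} (ht : t ∈ regularParams a)
    (hcoer : ∀ x, c * ‖x‖ ≤ ‖affineParam a t x‖) {g : (Fin N → ℝ) → Y} (hg : ‖g t‖ ≤ B) :
    ‖paramSolution a g t‖ ≤ c⁻¹ * B := by
  rw [inv_mul_eq_div, le_div_iff₀' hc]
  refine (hcoer _).trans ?_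
  rwa [affineParam_paramSolution g ht]

/-- Induction on the order: the first derivative `∂ᵢu` solves the same equation, and its source
`∂ᵢg - aᵢ u` has derivatives of order at most `n` bounded by `(1 + K Cₙ) B`. -/
theorem derivsBoundedBy_paramSolution [CompleteSpace X] {a : Fin (N + 1) → X →L[ℝ] Y} {c K : ℝ}
    (hc : 0 < c) (hK : 0 ≤ K) (hreg : paramCube N ⊆ regularParams a)
    (hcoer : ∀ t ∈ paramCube N, ∀ x, c * ‖x‖ ≤ ‖affineParam a t x‖)
    (haK : ∀ i : Fin N, ‖a i.succ‖ ≤ K) (n : ℕ) {B : ℝ} {g : (Fin N → ℝ) → Y}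
    (hg : ContDiffOn ℝ (⊤ : ℕ∞) g (regularParams a)) (hgB : DerivsBoundedBy n B g) :
    DerivsBoundedBy n (solutionConst c K n * B) (paramSolution a g) := by
  have hO := isOpen_regularParams a
  induction n generalizing g B with
  | zero =>
    intro s hs t ht
    obtain rfl : s = [] := List.length_eq_zero_iff.1 (Nat.le_zero.1 hs)
    exact norm_paramSolution_le hc (hreg ht) (hcoer t ht) (hgB [] le_rfl t ht)
  | succ n ih =>
    have hC := solutionConst_pos hc hK n
    intro s hs t ht
    have hB : 0 ≤ B := (norm_nonneg _).trans (hgB [] (Nat.zero_le _) t ht)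
    rw [solutionConst, add_mul]
    cases s with
    | nil =>
      refine (norm_paramSolution_le hc (hreg ht) (hcoer t ht)
        (hgB [] (Nat.zero_le _) t ht)).trans (le_add_of_nonneg_left ?_)
      positivity
    | cons i s =>
      have hu := contDiffOn_paramSolution a hg
      have hgi := hg.partialDeriv hO i
      rw [dirDeriv_cons,
        dirDeriv_eqOn hO s (partialDeriv_paramSolution_eqOn a hg i) (hreg ht)]
      have hsource : DerivsBoundedBy n ((1 + K * solutionConst c K n) * B)
          (fun t => partialDeriv i g t - a i.succ (paramSolution a g t)) := by
        intro r hr x hx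
        rw [dirDeriv_sub_clm_comp_eqOn hO (a i.succ) r hgi hu (hreg hx)]
        have h1 : ‖dirDeriv r (partialDeriv i g) x‖ ≤ B :=
          hgB (i :: r) (by simpa using hr) x hx
        have h2 : ‖dirDeriv r (paramSolution a g) x‖ ≤ solutionConst c K n * B :=
          ih hg (fun r hr => hgB r (hr.trans n.le_succ)) r hr x hx
        have h3 : ‖a i.succ (dirDeriv r (paramSolution a g) x)‖ ≤
            K * (solutionConst c K n * B) :=
          (a i.succ).le_of_opNorm_le_of_le (haK i) h2
        exact (norm_sub_le _ _).trans (by linarith)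
      have hdiff : ContDiffOn ℝ (⊤ : ℕ∞)
          (fun t => partialDeriv i g t - a i.succ (paramSolution a g t)) (regularParams a) :=
        hgi.sub ((a i.succ).contDiff.comp_contDiffOn hu)
      have := ih hdiff hsource s (by simpa using hs) t ht
      rw [mul_assoc]
      exact this.trans (le_add_of_nonneg_right (mul_nonneg (inv_nonneg.2 hc.le) hB))

end AffineParam

/-! ### Galerkin operators -/

section Galerkin

variable {N : ℕ} {𝒳 E V : Type*} [MeasurableSpace 𝒳] {ν : Measure 𝒳} [NormedAddCommGroup E]
  [InnerProductSpace ℝ E] [NormedAddCommGroup V] [NormedSpace ℝ V]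

/-- The bilinear form `∫ G u · G v`, read as an operator `V → V'`. -/
noncomputable def stiffnessOperator (G : V →L[ℝ] Lp E 2 ν) : V →L[ℝ] StrongDual ℝ V :=
  (innerSL ℝ).bilinearComp G G

/-- The bilinear form `∫ m (P u) (P v)` with weight `m ∈ L^∞`, read as an operator `V → V'`. -/
noncomputable def massOperator (P : V →L[ℝ] Lp ℝ 2 ν) (m : Lp ℝ ⊤ ν) : V →L[ℝ] StrongDual ℝ V :=
  (innerSL ℝ).bilinearComp (((ContinuousLinearMap.mul ℝ ℝ).holderL ν ⊤ 2 2 m).comp P) P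

/-- The coefficients of the operator `a₀ + ∑ᵢ tᵢ aᵢ : V → V'` of the Galerkin problem:
`a₀ u v = ∫ G u · G v + ∫ μ₀ (P u) (P v)` and `aᵢ u v = ∫ μᵢ (P u) (P v)` for `i ≥ 1`, where `P v`
is the function underlying `v` and `G v` its gradient. -/
noncomputable def galerkinOperator (P : V →L[ℝ] Lp ℝ 2 ν) (G : V →L[ℝ] Lp E 2 ν)
    (μ : Fin (N + 1) → Lp ℝ ⊤ ν) : Fin (N + 1) → V →L[ℝ] StrongDual ℝ V :=
  Fin.cons (stiffnessOperator G + massOperator P (μ 0)) fun i => massOperator P (μ i.succ)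

theorem massOperator_apply (P : V →L[ℝ] Lp ℝ 2 ν) (m : Lp ℝ ⊤ ν) (u v : V) :
    Integrable (fun x => m x * P u x * P v x) ν ∧
      massOperator P m u v = ∫ x, m x * P u x * P v x ∂ν := by
  set p : Lp ℝ 2 ν := (ContinuousLinearMap.mul ℝ ℝ).holder 2 m (P u) with hp
  have hae : (fun x => inner ℝ (p x) (P v x)) =ᵐ[ν] fun x => m x * P u x * P v x := by
    filter_upwards [(ContinuousLinearMap.mul ℝ ℝ).coeFn_holder (r := 2) m (P u)] with x hx
    rw [hp, hx]
    simp [mul_comm]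
  refine ⟨(L2.integrable_inner p (P v)).congr hae, ?_⟩
  rw [← integral_congr_ae hae, ← L2.inner_def]
  rfl

theorem norm_massOperator_le {P : V →L[ℝ] Lp ℝ 2 ν} (hP : ∀ v, ‖P v‖ ≤ ‖v‖) (m : Lp ℝ ⊤ ν) :
    ‖massOperator P m‖ ≤ ‖m‖ := by
  refine ContinuousLinearMap.opNorm_le_bound₂ _ (norm_nonneg m) fun u v => ?_
  have h1 : massOperator P m u v = inner ℝ
      ((ContinuousLinearMap.mul ℝ ℝ).holder (r := 2) m (P u)) (P v) := rfl
  rw [h1]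
  refine (norm_inner_le_norm _ _).trans ?_
  refine mul_le_mul ?_ (hP v) (norm_nonneg _) (by positivity)
  refine ((ContinuousLinearMap.mul ℝ ℝ).norm_holder_apply_apply_le m _).trans ?_
  rw [ContinuousLinearMap.opNorm_mul, one_mul]
  exact mul_le_mul_of_nonneg_left (hP u) (norm_nonneg m)

theorem integrable_affineParam_mul (P : V →L[ℝ] Lp ℝ 2 ν) (μ : Fin (N + 1) → Lp ℝ ⊤ ν)
    (t : Fin N → ℝ) (u v : V) :
    Integrable (fun x => affineParam (fun i => μ i x) t * P u x * P v x) ν := by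
  have hm := fun i => (massOperator_apply P (μ i) u v).1
  simp only [affineParam, smul_eq_mul, add_mul, Finset.sum_mul, mul_assoc] at hm ⊢
  exact (hm 0).add (integrable_finsetSum _ fun i _ => (hm i.succ).const_mul (t i))

theorem affineParam_galerkinOperator_apply (P : V →L[ℝ] Lp ℝ 2 ν) (G : V →L[ℝ] Lp E 2 ν)
    (μ : Fin (N + 1) → Lp ℝ ⊤ ν) (t : Fin N → ℝ) (u v : V) :
    affineParam (galerkinOperator P G μ) t u v =
      (∫ x, inner ℝ (G u x) (G v x) ∂ν) +
        ∫ x, affineParam (fun i => μ i x) t * P u x * P v x ∂ν := by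
  have hm := fun i => massOperator_apply P (μ i) u v
  have hg : inner ℝ (G u) (G v) = ∫ x, inner ℝ (G u x) (G v x) ∂ν := L2.inner_def _ _
  have hsum : ∫ x, affineParam (fun i => μ i x) t * P u x * P v x ∂ν =
      massOperator P (μ 0) u v + ∑ i : Fin N, t i * massOperator P (μ i.succ) u v := by
    simp only [fun i => (hm i).2, affineParam, smul_eq_mul, add_mul, Finset.sum_mul, mul_assoc]
    simp only [mul_assoc] at hm
    rw [integral_add (hm 0).1 (integrable_finsetSum _ fun i _ => (hm i.succ).1.const_mul (t i)),
      integral_finsetSum _ fun i _ => (hm i.succ).1.const_mul (t i)]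
    simp only [integral_const_mul]
  rw [hsum, ← hg]
  simp [affineParam, galerkinOperator, stiffnessOperator, add_assoc]

/-- Coercivity in the full `H¹` norm. It comes from the lower bound on the potential, so that no
Poincaré inequality is involved. -/
theorem mul_norm_le_norm_galerkinOperator {P : V →L[ℝ] Lp ℝ 2 ν} {G : V →L[ℝ] Lp E 2 ν}
    (hPG : ∀ v, ‖v‖ ^ 2 = ‖P v‖ ^ 2 + ‖G v‖ ^ 2) (μ : Fin (N + 1) → Lp ℝ ⊤ ν) {t : Fin N → ℝ}
    {μmin : ℝ} (hμ : ∀ᵐ x ∂ν, μmin ≤ affineParam (fun i => μ i x) t) (v : V) :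
    min 1 μmin * ‖v‖ ≤ ‖affineParam (galerkinOperator P G μ) t v‖ := by
  rcases eq_or_ne v 0 with rfl | hv
  · simp
  have hP : Integrable (fun x => P v x * P v x) ν := L2.integrable_inner (𝕜 := ℝ) (P v) (P v)
  have hP2 : ∫ x, P v x * P v x ∂ν = ‖P v‖ ^ 2 := by
    rw [← real_inner_self_eq_norm_sq, L2.inner_def]
    rfl
  have hG2 : ∫ x, inner ℝ (G v x) (G v x) ∂ν = ‖G v‖ ^ 2 := by
    rw [← real_inner_self_eq_norm_sq, L2.inner_def]
  have hmono : μmin * ‖P v‖ ^ 2 ≤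
      ∫ x, affineParam (fun i => μ i x) t * P v x * P v x ∂ν := by
    rw [← hP2, ← integral_const_mul]
    refine integral_mono_ae (hP.const_mul μmin) (integrable_affineParam_mul P μ t v v) ?_
    filter_upwards [hμ] with x hx
    simpa only [mul_assoc] using mul_le_mul_of_nonneg_right hx (mul_self_nonneg (P v x))
  have hlow : min 1 μmin * ‖v‖ ^ 2 ≤ affineParam (galerkinOperator P G μ) t v v := by
    rw [affineParam_galerkinOperator_apply, hG2, hPG, mul_add]
    have h1 := mul_le_mul_of_nonneg_right (min_le_left 1 μmin) (sq_nonneg ‖G v‖)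
    have h2 := mul_le_mul_of_nonneg_right (min_le_right 1 μmin) (sq_nonneg ‖P v‖)
    linarith
  have hup := (le_abs_self _).trans ((affineParam (galerkinOperator P G μ) t v).le_opNorm v)
  refine le_of_mul_le_mul_right ?_ (norm_pos_iff.2 hv)
  rw [mul_assoc, ← pow_two]
  exact hlow.trans hup

/-- Between a finite-dimensional space and its dual, an operator bounded below is invertible. -/
theorem mem_range_equiv_of_mul_norm_le [FiniteDimensional ℝ V] (A : V →L[ℝ] StrongDual ℝ V)
    {c : ℝ} (hc : 0 < c) (hA : ∀ v, c * ‖v‖ ≤ ‖A v‖) :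
    A ∈ Set.range ((↑) : (V ≃L[ℝ] StrongDual ℝ V) → V →L[ℝ] StrongDual ℝ V) := by
  have hinj : Function.Injective (A : V →ₗ[ℝ] StrongDual ℝ V) := by
    refine (injective_iff_map_eq_zero _).2 fun v hv => ?_
    have h := hA v
    rw [show A v = 0 from hv, norm_zero] at h
    exact norm_le_zero_iff.1 (nonpos_of_mul_nonpos_right h hc)
  let e : Module.Dual ℝ V ≃ₗ[ℝ] StrongDual ℝ V := LinearMap.toContinuousLinearMap
  have hdim : Module.finrank ℝ V = Module.finrank ℝ (StrongDual ℝ V) := by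
    rw [← e.finrank_eq, Subspace.dual_finrank_eq]
  have : FiniteDimensional ℝ (StrongDual ℝ V) := e.finiteDimensional
  refine ⟨(LinearEquiv.ofInjectiveOfFinrankEq _ hinj hdim).toContinuousLinearEquiv, ?_⟩
  ext v w
  rfl

/-- A bound for almost every `(x, t)` holds, for almost every `x`, at all `t` in the cube, since the
potential is continuous in `t` and the cube is the closure of its interior. -/
theorem ae_forall_paramCube_le [SFinite ν] {μ : Fin (N + 1) → 𝒳 → ℝ} {μmin : ℝ}
    (h : ∀ᵐ p ∂(ν.prod (volume.restrict (paramCube N))),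
      μmin ≤ affineParam (fun i => μ i p.1) p.2) :
    ∀ᵐ x ∂ν, ∀ t ∈ paramCube N, μmin ≤ affineParam (fun i => μ i x) t := by
  filter_upwards [Measure.ae_ae_of_ae_prod h] with x hx t ht
  have hclosed : IsClosed {t | μmin ≤ affineParam (fun i => μ i x) t} :=
    isClosed_le continuous_const (contDiff_affineParam (n := 0) _).continuous
  have hcl : closure (interior (paramCube N)) = paramCube N := by
    refine ((convex_Icc (𝕜 := ℝ) (0 : Fin N → ℝ) 1).closure_interior_eq_closure_of_nonempty_interior
      ?_).trans isClosed_Icc.closure_eq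
    rw [← Set.pi_univ_Icc, interior_pi_set Set.finite_univ]
    exact ⟨fun _ => 1 / 2, fun i _ => by norm_num⟩
  rw [← hcl] at ht
  have hx' : ∀ᵐ t ∂(volume.restrict (interior (paramCube N))),
      t ∈ {t | μmin ≤ affineParam (fun i => μ i x) t} :=
    ae_restrict_of_ae_restrict_of_subset interior_subset hx
  refine hclosed.closure_subset_iff.2 (fun s hs => ?_) ht
  by_contra hn
  -- A violation at an interior point persists on a nonempty open set, which has positive measure.
  have hopen : IsOpen (interior (paramCube N) ∩ {t | μmin ≤ affineParam (fun i => μ i x) t}ᶜ) :=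
    isOpen_interior.inter hclosed.isOpen_compl
  refine (hopen.measure_pos volume ⟨s, hs, hn⟩).ne' ?_
  rw [ae_iff, Measure.restrict_apply' isOpen_interior.measurableSet] at hx'
  rwa [Set.inter_comm]

/-- At every parameter in the cube the Galerkin operator is invertible. -/
theorem paramCube_subset_regularParams [FiniteDimensional ℝ V] [SFinite ν] {P : V →L[ℝ] Lp ℝ 2 ν}
    {G : V →L[ℝ] Lp E 2 ν} (hPG : ∀ v, ‖v‖ ^ 2 = ‖P v‖ ^ 2 + ‖G v‖ ^ 2)
    (μ : Fin (N + 1) → Lp ℝ ⊤ ν) {μmin : ℝ} (hμmin : 0 < μmin)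
    (h : ∀ t ∈ paramCube N, ∀ᵐ x ∂ν, μmin ≤ affineParam (fun i => μ i x) t) :
    paramCube N ⊆ regularParams (galerkinOperator P G μ) := fun t ht =>
  mem_range_equiv_of_mul_norm_le _ (lt_min one_pos hμmin)
    (mul_norm_le_norm_galerkinOperator hPG μ (h t ht))

/-- The derivatives of the Galerkin solution are bounded in terms of the source, with a constant
determined by the order, by the lower bound of the potential and by its `L^∞` coefficients. -/
theorem derivsBoundedBy_galerkin [FiniteDimensional ℝ V] [SFinite ν] {P : V →L[ℝ] Lp ℝ 2 ν}
    {G : V →L[ℝ] Lp E 2 ν} (hPG : ∀ v, ‖v‖ ^ 2 = ‖P v‖ ^ 2 + ‖G v‖ ^ 2)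
    (μ : Fin (N + 1) → Lp ℝ ⊤ ν) {μmin K B : ℝ} (hμmin : 0 < μmin) (hK : ∀ i, ‖μ i‖ ≤ K)
    (h : ∀ t ∈ paramCube N, ∀ᵐ x ∂ν, μmin ≤ affineParam (fun i => μ i x) t)
    {f : Fin (N + 1) → StrongDual ℝ V} (hf0 : ∀ t ∈ paramCube N, ‖affineParam f t‖ ≤ B)
    (hf1 : ∀ i : Fin N, ‖f i.succ‖ ≤ B) (n : ℕ) :
    DerivsBoundedBy n (solutionConst (min 1 μmin) K n * B)
      (paramSolution (galerkinOperator P G μ) (affineParam f)) := by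
  have := FiniteDimensional.complete ℝ V
  have hP : ∀ v, ‖P v‖ ≤ ‖v‖ := fun v => by
    refine le_of_sq_le_sq ?_ (norm_nonneg v)
    rw [hPG]
    exact le_add_of_nonneg_right (sq_nonneg _)
  exact derivsBoundedBy_paramSolution (lt_min one_pos hμmin) ((norm_nonneg _).trans (hK 0))
    (paramCube_subset_regularParams hPG μ hμmin h)
    (fun t ht => mul_norm_le_norm_galerkinOperator hPG μ (h t ht))
    (fun i => (norm_massOperator_le hP _).trans (hK i.succ)) n
    (contDiff_affineParam f).contDiffOn (derivsBoundedBy_affineParam hf0 hf1 n)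

end Galerkin

/-! ### Dual norms over the parameter cube -/

section DualNorm

variable {N : ℕ} {H Y : Type*} [NormedAddCommGroup H] [NormedAddCommGroup Y]

/-- The norm `(∫_{Ω_t} ‖G (v t)‖² dt)^{1/2}`, for a map `G` in the role of the gradient. -/
noncomputable def gradNorm (G : H → Y) (v : (Fin N → ℝ) → H) : ENNReal :=
  eLpNorm (fun t => G (v t)) 2 (volume.restrict (paramCube N))

theorem gradNorm_le_of_ae_norm_le {G : H → Y} (hG : ∀ v, ‖G v‖ ≤ ‖v‖)
    {v : (Fin N → ℝ) → H} {B : ℝ}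
    (hv : ∀ᵐ t ∂(volume.restrict (paramCube N)), ‖v t‖ ≤ B) : gradNorm G v ≤ ENNReal.ofReal B := by
  refine (eLpNorm_le_of_ae_bound (hv.mono fun t ht => (hG _).trans ht)).trans ?_
  simp

variable [NormedSpace ℝ H]

/-- The dual norm of `F` with respect to `gradNorm G`, tested against `L²(Ω_t; H)`. -/
noncomputable def gradDualNorm (G : H → Y) (F : (Fin N → ℝ) → StrongDual ℝ H) : ENNReal :=
  ⨆ (v : Lp H 2 (volume.restrict (paramCube N))) (_ : v ≠ 0),
    ENNReal.ofReal (∫ t in paramCube N, F t (v t)) / gradNorm G v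

theorem norm_le_of_forall_apply_le {g : StrongDual ℝ H} {B : ℝ} (hB : 0 ≤ B)
    (h : ∀ v, g v ≤ B * ‖v‖) : ‖g‖ ≤ B := by
  refine g.opNorm_le_bound hB fun v => abs_le.2 ⟨?_, h v⟩
  have := h (-v)
  rw [map_neg, norm_neg] at this
  linarith

/-- The value of `f₀ + ∑ᵢ tᵢ fᵢ` at a point of the cube differs from its mean over the cube by at
most the sum of the norms of the `fᵢ`, `i ≥ 1`. -/
theorem norm_affineParam_le_of_integral_le (f : Fin (N + 1) → StrongDual ℝ H)
    {W : ℝ} {D : Fin N → ℝ} (hW0 : 0 ≤ W)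
    (hW : ∀ v, ∫ t in paramCube N, affineParam f t v ≤ W * ‖v‖) (hD : ∀ i : Fin N, ‖f i.succ‖ ≤ D i)
    {t : Fin N → ℝ} (ht : t ∈ paramCube N) : ‖affineParam f t‖ ≤ W + ∑ i, D i := by
  have hD0 : 0 ≤ ∑ i, D i := Finset.sum_nonneg fun i _ => (norm_nonneg _).trans (hD i)
  refine norm_le_of_forall_apply_le (add_nonneg hW0 hD0) fun v => ?_
  have hdiff : ∀ s ∈ paramCube N, affineParam f t v - (∑ i, D i) * ‖v‖ ≤ affineParam f s v := by
    intro s hs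
    have hterm : ∀ i : Fin N, t i * f i.succ v ≤ s i * f i.succ v +
        D i * ‖v‖ := by
      intro i
      have h1 : |f i.succ v| ≤ D i * ‖v‖ :=
        (f i.succ).le_of_opNorm_le (hD i) v
      have h2 : |t i - s i| ≤ 1 := abs_sub_le_iff.2
        ⟨by linarith [ht.2 i, hs.1 i, Pi.zero_apply (M := fun _ : Fin N => ℝ) i,
            Pi.one_apply (M := fun _ : Fin N => ℝ) i],
          by linarith [ht.1 i, hs.2 i, Pi.zero_apply (M := fun _ : Fin N => ℝ) i,
            Pi.one_apply (M := fun _ : Fin N => ℝ) i]⟩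
      have h3 : (t i - s i) * f i.succ v ≤ |f i.succ v| := by
        refine (le_abs_self _).trans ?_
        rw [abs_mul]
        exact mul_le_of_le_one_left (abs_nonneg _) h2
      linarith
    have hsum := Finset.sum_le_sum fun i (_ : i ∈ Finset.univ) => hterm i
    rw [Finset.sum_add_distrib, ← Finset.sum_mul] at hsum
    rw [affineParam_apply_clm, affineParam_apply_clm]
    simp only [affineParam, smul_eq_mul]
    linarith
  have hm : MeasurableSet (paramCube N) := measurableSet_Icc
  have hcont : Continuous fun s => affineParam f s v :=
    ((contDiff_affineParam (n := 0) f).continuous).clm_apply continuous_const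
  have hint : ∫ _ in paramCube N, (affineParam f t v - (∑ i, D i) * ‖v‖) ≤
      ∫ s in paramCube N, affineParam f s v :=
    setIntegral_mono_on (integrable_const _)
      (hcont.continuousOn.integrableOn_compact (isCompact_paramCube N)) hm hdiff
  rw [integral_const, probReal_univ, one_smul] at hint
  have := hint.trans (hW v)
  linarith

/-- Testing the dual norm with a function that does not depend on the parameter. -/
theorem integral_apply_le_gradDualNorm {G : H → Y} (hG : ∀ v, ‖G v‖ ≤ ‖v‖)
    (F : (Fin N → ℝ) → StrongDual ℝ H)
    (hF : gradDualNorm G F ≠ ⊤) (v : H) :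
    ∫ t in paramCube N, F t v ≤ (gradDualNorm G F).toReal * ‖v‖ := by
  rcases eq_or_ne v 0 with rfl | hv
  · simp
  set c : Lp H 2 (volume.restrict (paramCube N)) := Lp.const 2 _ v with hc
  have hcv : c =ᵐ[volume.restrict (paramCube N)] fun _ => v := Lp.coeFn_const 2 _ v
  have hc0 : c ≠ 0 := by
    intro h
    have hnorm : ‖c‖ = ‖v‖ := by simp [hc, Lp.norm_const]
    rw [h, norm_zero] at hnorm
    exact hv (norm_eq_zero.1 hnorm.symm)
  have hint : ∫ t in paramCube N, F t (c t) = ∫ t in paramCube N, F t v :=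
    integral_congr_ae (hcv.mono fun t ht => congrArg (F t) ht)
  have hw : gradNorm G c ≤ ENNReal.ofReal ‖v‖ :=
    gradNorm_le_of_ae_norm_le hG (hcv.mono fun t ht => (congrArg norm ht).le)
  have hle : ENNReal.ofReal (∫ t in paramCube N, F t (c t)) / gradNorm G c ≤ gradDualNorm G F :=
    le_iSup₂_of_le c hc0 le_rfl
  rw [hint] at hle
  have h2 := (ENNReal.div_le_div_left hw _).trans hle
  rw [ENNReal.div_le_iff (by simpa using hv) ENNReal.ofReal_ne_top, ← ENNReal.ofReal_toReal hF,
    ← ENNReal.ofReal_mul ENNReal.toReal_nonneg] at h2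
  exact (ENNReal.ofReal_le_ofReal_iff (by positivity)).1 h2

theorem norm_coeff_le_gradDualNorm {G : H → Y} (hG : ∀ v, ‖G v‖ ≤ ‖v‖)
    (f : Fin (N + 1) → StrongDual ℝ H) (i : Fin N)
    (hf : gradDualNorm G (partialDeriv i (affineParam f)) ≠ ⊤) :
    ‖f i.succ‖ ≤ (gradDualNorm G (partialDeriv i (affineParam f))).toReal := by
  refine norm_le_of_forall_apply_le ENNReal.toReal_nonneg fun v => ?_
  refine le_of_eq_of_le ?_ (integral_apply_le_gradDualNorm hG _ hf v)
  simp [partialDeriv_affineParam]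

theorem norm_affineParam_le_gradDualNorm {G : H → Y} (hG : ∀ v, ‖G v‖ ≤ ‖v‖)
    (f : Fin (N + 1) → StrongDual ℝ H)
    (hf0 : gradDualNorm G (affineParam f) ≠ ⊤)
    (hf1 : ∀ i : Fin N, gradDualNorm G (partialDeriv i (affineParam f)) ≠ ⊤)
    {t : Fin N → ℝ} (ht : t ∈ paramCube N) :
    ‖affineParam f t‖ ≤ (gradDualNorm G (affineParam f)).toReal +
      ∑ i : Fin N, (gradDualNorm G (partialDeriv i (affineParam f))).toReal :=
  norm_affineParam_le_of_integral_le f ENNReal.toReal_nonneg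
    (integral_apply_le_gradDualNorm hG _ hf0)
    (fun i => norm_coeff_le_gradDualNorm hG f i (hf1 i)) ht

/-- If the `v α` are pointwise bounded by `S B` whenever `B` bounds the source and its first
derivatives, then they are bounded by the dual norms, whose sum is an admissible `B`. -/
theorem sum_gradNorm_le {G : H → Y} (hG : ∀ v, ‖G v‖ ≤ ‖v‖) {ι : Type*} (s : Finset ι)
    (f : Fin (N + 1) → StrongDual ℝ H) {S : ℝ} (hS : 0 ≤ S) (v : ι → (Fin N → ℝ) → H)
    (h : ∀ B : ℝ, (∀ t ∈ paramCube N, ‖affineParam f t‖ ≤ B) → (∀ i : Fin N, ‖f i.succ‖ ≤ B) →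
      ∀ α ∈ s, ∀ᵐ t ∂(volume.restrict (paramCube N)), ‖v α t‖ ≤ S * B) :
    ∑ α ∈ s, gradNorm G (v α) ≤ (s.card * S.toNNReal + 1 : NNReal) *
      (gradDualNorm G (affineParam f) +
        ∑ i : Fin N, gradDualNorm G (partialDeriv i (affineParam f))) := by
  generalize hR' : gradDualNorm G (affineParam f) +
    ∑ i : Fin N, gradDualNorm G (partialDeriv i (affineParam f)) = R
  rcases eq_or_ne R ⊤ with hR | hR
  · -- The summand `1` keeps the constant positive, so that an infinite dual norm bounds everything.
    rw [hR, ENNReal.mul_top (by simp)]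
    exact le_top
  have hfin := ENNReal.add_ne_top.1 (hR'.trans_ne hR)
  have hfin1 : ∀ i : Fin N, gradDualNorm G (partialDeriv i (affineParam f)) ≠ ⊤ := fun i =>
    ENNReal.sum_ne_top.1 hfin.2 i (Finset.mem_univ i)
  have hRreal : R.toReal = (gradDualNorm G (affineParam f)).toReal +
      ∑ i : Fin N, (gradDualNorm G (partialDeriv i (affineParam f))).toReal := by
    rw [← hR', ENNReal.toReal_add hfin.1 hfin.2, ENNReal.toReal_sum fun i _ => hfin1 i]
  have hbound := h R.toReal
    (fun t ht => hRreal ▸ norm_affineParam_le_gradDualNorm hG f hfin.1 hfin1 ht)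
    (fun i => (norm_coeff_le_gradDualNorm hG f i (hfin1 i)).trans (by
      rw [hRreal]
      exact (Finset.single_le_sum
        (f := fun i : Fin N => (gradDualNorm G (partialDeriv i (affineParam f))).toReal)
        (fun j _ => ENNReal.toReal_nonneg) (Finset.mem_univ i)).trans
          (le_add_of_nonneg_left ENNReal.toReal_nonneg)))
  have hterm : ∀ α ∈ s, gradNorm G (v α) ≤ S.toNNReal * R := fun α hα => by
    refine (gradNorm_le_of_ae_norm_le hG (hbound α hα)).trans_eq ?_
    rw [ENNReal.ofReal_mul hS, ENNReal.ofReal_toReal hR]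
    rfl
  refine (Finset.sum_le_card_nsmul _ _ _ hterm).trans ?_
  rw [nsmul_eq_mul, ← mul_assoc]
  push_cast
  exact mul_le_mul_left (le_add_of_nonneg_right zero_le) R

end DualNorm

/-! ### The Galerkin problem -/

section GalerkinSubspace

variable {N : ℕ} {𝒳 E H : Type*} [MeasurableSpace 𝒳] {ν : Measure 𝒳} [NormedAddCommGroup E]
  [InnerProductSpace ℝ E] [NormedAddCommGroup H] [NormedSpace ℝ H]

/-- The Galerkin problem in a finite-dimensional subspace `V` of an abstract energy space `H`, in
which `P v` plays the role of the function underlying `v` and `G v` that of its gradient; `S t u`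
says that `u` solves the problem at `t`. Any `u` solving it almost everywhere agrees almost
everywhere with the smooth `paramSolution`, whose classical derivatives are the weak ones. -/
theorem galerkin_regularity [SFinite ν] (V : Submodule ℝ H) [FiniteDimensional ℝ V]
    {P : H →L[ℝ] Lp ℝ 2 ν} {G : H →L[ℝ] Lp E 2 ν} (hPG : ∀ v, ‖v‖ ^ 2 = ‖P v‖ ^ 2 + ‖G v‖ ^ 2)
    (μ : Fin (N + 1) → Lp ℝ ⊤ ν) {μmin K : ℝ} (hμmin : 0 < μmin) (hK : ∀ i, ‖μ i‖ ≤ K)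
    (h : ∀ t ∈ paramCube N, ∀ᵐ x ∂ν, μmin ≤ affineParam (fun i => μ i x) t)
    (k : ℕ) (f : Fin (N + 1) → StrongDual ℝ H) {S : (Fin N → ℝ) → V → Prop}
    (hS : ∀ t u, S t u ↔ ∀ v : V, (∫ x, inner ℝ (G (u : H) x) (G (v : H) x) ∂ν) +
      (∫ x, affineParam (fun i => μ i x) t * P (u : H) x * P (v : H) x ∂ν) =
        affineParam f t (v : H)) :
    (∀ t ∈ paramCube N, ∃! v : V, S t v) ∧
    ∀ u : (Fin N → ℝ) → V, (∀ᵐ t ∂(volume.restrict (paramCube N)), S t (u t)) →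
      MemHk k u ∧ MemHk k (fun t => (u t : H)) ∧
      ∀ w : (Fin N → ℕ) → (Fin N → ℝ) → V,
        (∀ α ∈ multiIndices N k, IsL2WeakDeriv α u (w α)) →
        ∑ α ∈ multiIndices N k, gradNorm G (fun t => (w α t : H)) ≤
          ((multiIndices N k).card * (solutionConst (min 1 μmin) K k).toNNReal + 1 : NNReal) *
            (gradDualNorm G (affineParam f) +
              ∑ i : Fin N, gradDualNorm G (partialDeriv i (affineParam f))) := by
  have := FiniteDimensional.complete ℝ V
  set a := galerkinOperator (P.comp V.subtypeL) (G.comp V.subtypeL) μ with ha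
  set F : Fin (N + 1) → StrongDual ℝ V := fun i => (f i).comp V.subtypeL with hF
  have hFf : ∀ t (v : V), affineParam F t v = affineParam f t (v : H) := fun t v => by
    simp [hF, affineParam]
  have hPGV : ∀ v : V, ‖v‖ ^ 2 = ‖P.comp V.subtypeL v‖ ^ 2 + ‖G.comp V.subtypeL v‖ ^ 2 :=
    fun v => hPG v
  have hSa : ∀ t u, S t u ↔ affineParam a t u = affineParam F t := fun t u => by
    rw [hS, ContinuousLinearMap.ext_iff]
    refine forall_congr' fun v => ?_
    rw [ha, affineParam_galerkinOperator_apply, hFf]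
    rfl
  have hQO := paramCube_subset_regularParams hPGV μ hμmin h
  have hO := isOpen_regularParams a
  have hU := contDiffOn_paramSolution a (contDiff_affineParam (n := (⊤ : ℕ∞)) F).contDiffOn
  refine ⟨fun t ht => ⟨paramSolution a (affineParam F) t, ?_, fun v hv => ?_⟩, fun u hu => ?_⟩
  · exact (hSa t _).2 (affineParam_paramSolution _ (hQO ht))
  · exact eq_paramSolution (hQO ht) ((hSa t v).1 hv)
  have huU : u =ᵐ[volume.restrict (paramCube N)] paramSolution a (affineParam F) := by
    have hm : MeasurableSet (paramCube N) := measurableSet_Icc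
    filter_upwards [hu, ae_restrict_mem hm] with t ht htQ
    exact eq_paramSolution (hQO htQ) ((hSa t _).1 ht)
  have hG : ∀ v, ‖G v‖ ≤ ‖v‖ := fun v => by
    refine le_of_sq_le_sq ?_ (norm_nonneg v)
    rw [hPG]
    exact le_add_of_nonneg_left (sq_nonneg _)
  refine ⟨memHk_of_ae_eq_contDiffOn hO hQO hU huU k,
    memHk_of_ae_eq_contDiffOn hO hQO (V.subtypeL.contDiff.comp_contDiffOn hU)
      (huU.fun_comp V.subtypeL) k, fun w hw => ?_⟩
  refine sum_gradNorm_le hG _ f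
    (solutionConst_pos (lt_min one_pos hμmin) ((norm_nonneg _).trans (hK 0)) k).le
    (fun α t => (w α t : H)) fun B hB0 hB1 α hα => ?_
  have hrestrict : ∀ g : StrongDual ℝ H, ‖g.comp V.subtypeL‖ ≤ ‖g‖ := fun g =>
    ContinuousLinearMap.opNorm_le_bound _ (norm_nonneg g) fun v => g.le_opNorm v
  have hbound := derivsBoundedBy_galerkin hPGV μ hμmin hK h (f := F) (B := B)
    (fun t ht => by
      have hres : affineParam F t = (affineParam f t).comp V.subtypeL :=
        ContinuousLinearMap.ext (hFf t)
      rw [hres]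
      exact (hrestrict _).trans (hB0 t ht))
    (fun i => (hrestrict _).trans (hB1 i)) k
  have hm : MeasurableSet (paramCube N) := measurableSet_Icc
  filter_upwards [(hw α hα).ae_eq (isL2WeakDeriv_dirDeriv hO hQO hU huU α), ae_restrict_mem hm]
    with t ht htQ
  rw [ht]
  exact hbound _ ((length_multiIndexDirs α).trans_le (Finset.mem_filter.1 hα).2) t htQ

end GalerkinSubspace

/-! ### Specialization to `H₀¹(Ω)` -/

/-- The function underlying an element of `H₀¹(Ω)`, as a bounded operator. -/
noncomputable def fnL {d : ℕ} (Ω : Set (EuclideanSpace ℝ (Fin d))) :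
    H01 Ω →L[ℝ] Lp ℝ 2 (volume.restrict Ω) :=
  (WithLp.fstL 2 ℝ (Lp ℝ 2 (volume.restrict Ω))
    (Lp (EuclideanSpace ℝ (Fin d)) 2 (volume.restrict Ω))).comp (H01 Ω).subtypeL

/-- The weak gradient of an element of `H₀¹(Ω)`, as a bounded operator. -/
noncomputable def gradL {d : ℕ} (Ω : Set (EuclideanSpace ℝ (Fin d))) :
    H01 Ω →L[ℝ] Lp (EuclideanSpace ℝ (Fin d)) 2 (volume.restrict Ω) :=
  (WithLp.sndL 2 ℝ (Lp ℝ 2 (volume.restrict Ω))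
    (Lp (EuclideanSpace ℝ (Fin d)) 2 (volume.restrict Ω))).comp (H01 Ω).subtypeL

theorem H01.norm_sq_eq {d : ℕ} {Ω : Set (EuclideanSpace ℝ (Fin d))} (v : H01 Ω) :
    ‖v‖ ^ 2 = ‖fnL Ω v‖ ^ 2 + ‖gradL Ω v‖ ^ 2 :=
  WithLp.prod_norm_sq_eq_of_L2 (v : WithLp 2 (Lp ℝ 2 (volume.restrict Ω) ×
    Lp (EuclideanSpace ℝ (Fin d)) 2 (volume.restrict Ω)))

theorem mainTheorem6 (d N : ℕ) (hd : d = 2 ∨ d = 3) (hN : 1 ≤ N)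
    (Ω : Set (EuclideanSpace ℝ (Fin d))) (hΩ : IsConvexPolyhedralDomain Ω ∨ IsC11Domain Ω)
    (μmin μmax : ℝ) (hμmin : 0 < μmin) (hμmax : μmin ≤ μmax) (M : Fin (N + 1) → ℝ) (k : ℕ) :
    ∃ C : NNReal,
      ∀ (μ : Fin (N + 1) → Lp ℝ ⊤ (volume.restrict Ω)) (f : Fin (N + 1) → StrongDual ℝ (H01 Ω))
        (V : Submodule ℝ (H01 Ω)), FiniteDimensional ℝ V →
        (∀ i, ‖μ i‖ = M i) →
        (∀ᵐ p ∂((volume.restrict Ω).prod (volume.restrict (paramCube N))),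
          μmin ≤ affineParam (fun i => μ i p.1) p.2 ∧
            affineParam (fun i => μ i p.1) p.2 ≤ μmax) →
        (∀ t ∈ paramCube N, ∃! v : V, IsGalerkinSolution μ f V t v) ∧
        ∀ u : (Fin N → ℝ) → V,
          (∀ᵐ t ∂(volume.restrict (paramCube N)), IsGalerkinSolution μ f V t (u t)) →
          MemHk k u ∧ MemHk k (fun t => (u t : H01 Ω)) ∧
          ∀ w : (Fin N → ℕ) → (Fin N → ℝ) → V,
            (∀ α ∈ multiIndices N k, IsL2WeakDeriv α u (w α)) →
            ∑ α ∈ multiIndices N k, wNorm (fun t => (w α t : H01 Ω)) ≤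
              C * (wDualNorm (affineParam f) +
                ∑ i : Fin N, wDualNorm (partialDeriv i (affineParam f))) := by
  refine ⟨(multiIndices N k).card * (solutionConst (min 1 μmin) (∑ j, |M j|) k).toNNReal + 1,
    fun μ f V hV hM hμ => ?_⟩
  exact galerkin_regularity V H01.norm_sq_eq μ hμmin
    (fun i => (hM i).trans_le ((le_abs_self _).trans
      (Finset.single_le_sum (fun j _ => abs_nonneg (M j)) (Finset.mem_univ i))))
    (fun t ht => (ae_forall_paramCube_le (μ := fun i x => μ i x)
      (hμ.mono fun p hp => hp.1)).mono fun x hx => hx t ht) k f (S := IsGalerkinSolution μ f V)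
    (fun t u => Iff.rfl)
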